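/- Let $\boldsymbol{\mu}$ be the Möbius function. Call two bounded real sequences $\xi,\eta$ indexed by the positive integers \emph{strongly} (resp. \emph{weakly}) correlated if $$\liminf_{n\to\infty}\frac1n\sum_{i=1}^n\xi(i)\eta(i)>0\qquad\Bigl(\text{resp. }\limsup_{n\to\infty}\frac1n\sum_{i=1}^n\xi(i)\eta(i)>0\Bigr);$$ a two-sided sequence is said to be correlated with $\boldsymbol{\mu}$ if its restriction to the positive integers is. A sequence $x$ indexed by $\mathbb Z$ is a \emph{Toeplitz sequence} if for every $n\in\mathbb Z$ there is an integer $p\ge1$ with $x(n)=x(n+mp)$ for all $m\in\mathbb Z$. A \emph{Toeplitz subshift} is the closure, in the product topology, of the shift orbit of a Toeplitz sequence over a finite alphabet. It is \emph{regular} if its Toeplitz sequences form a set of full measure for every shift-invariant Borel probability measure on it, and \emph{irregular} otherwise. There exists an irregular Toeplitz subshift $X\subset\{-1,1\}^{\mathbb Z}$ such that some $x\in X$ are strongly correlated with $\boldsymbol{\mu}$, the set of $x\in X$ strongly correlated with $\boldsymbol{\mu}$ is dense in $X$, and the set of $x\in X$ weakly correlated with $\boldsymbol{\mu}$ is residual in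 $X$ (its complement in $X$ is meager). -/

import Mathlib

open Filter MeasureTheory SymbolicDynamics SymbolicDynamics.FullShift

noncomputable section

namespace ToeplitzMoebius

/-- A two-sided sequence `x` is a *Toeplitz sequence* (it is regularly recurrent under the shift)
if every position belongs to the `p`-periodic part of `x` for some positive integer `p`. -/
def IsToeplitzSeq {A : Type*} (x : ℤ → A) : Prop :=
  ∀ n : ℤ, ∃ p : ℕ, 0 < p ∧ ∀ m : ℤ, x n = x (n + m * p)

/-- A two-sided subshift is a *Toeplitz subshift* if it is the orbit closure, under the shift,
of some Toeplitz sequence. -/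
def IsToeplitzSubshift {A : Type*} [TopologicalSpace A] (X : Subshift A ℤ) : Prop :=
  ∃ x : ℤ → A, IsToeplitzSeq x ∧ X.carrier = closure (Set.range fun k : ℤ => shift k x)

/-- A Toeplitz subshift over a finite discrete alphabet (so that the product σ-algebra is the Borel
σ-algebra) is *regular* if its set of regularly recurrent points, that is, of Toeplitz sequences,
has full measure for every shift-invariant Borel probability measure carried by the subshift. -/
def IsRegular {A : Type*} [TopologicalSpace A] [MeasurableSpace A] (X : Subshift A ℤ) : Prop :=
  ∀ ν : Measure (ℤ → A), IsProbabilityMeasure ν →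
    MeasurePreserving (shift (1 : ℤ)) ν ν → (∀ᵐ x ∂ν, x ∈ X.carrier) →
      ∀ᵐ x ∂ν, IsToeplitzSeq x

/-- The averages `(1 / n) * ∑_{i = 1}^{n} ξ(i) η(i)`. -/
def corrAvg (ξ η : ℕ → ℝ) (n : ℕ) : ℝ :=
  (1 / (n : ℝ)) * ∑ i ∈ Finset.Icc 1 n, ξ i * η i

/-- Bounded real sequences are *strongly correlated* if the lower limit of the correlation averages
is positive. -/
def StronglyCorrelated (ξ η : ℕ → ℝ) : Prop :=
  0 < liminf (corrAvg ξ η) atTop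

/-- Bounded real sequences are *weakly correlated* if the upper limit of the correlation averages
is positive. -/
def WeaklyCorrelated (ξ η : ℕ → ℝ) : Prop :=
  0 < limsup (corrAvg ξ η) atTop

/-- The Möbius function as a real sequence. -/
def mu (n : ℕ) : ℝ := (ArithmeticFunction.moebius n : ℝ)

/-- The two-letter alphabet `{-1, 1}`, with the (discrete) topology and σ-algebra inherited
from `ℤ`. -/
abbrev Sign : Type := ({-1, 1} : Set ℤ)

/-- The forward part `(x(n))_{n ≥ 0}` of a two-sided `{-1, 1}`-valued sequence, as a real
sequence. -/
def fwd (x : ℤ → Sign) (n : ℕ) : ℝ := ((x (n : ℤ) : ℤ) : ℝ)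

end ToeplitzMoebius

end

/-!
The subshift is generated by a Toeplitz sequence `base` that is built in stages. Stage `j` writes
the letter `letter j` at all positions of a residue class modulo `period j` that are not yet
written. The periods are pairwise coprime, the sum of their reciprocals is at most `1 / 32`, the
residue classes exhaust `ℤ`, and both letters are used infinitely often. Moving the residue
classes independently gives the points `ω` of the odometer, the product of the groups `ZMod
(period j)`; for most `ω` many positions are never written, and `fill ω b` fills these with the
values of an arbitrary sequence `b`. The sequence `base` itself is the case `ω = 0`, in which no
position is left over.

* The subshift contains `fill ω b` for all `ω` and `b` (`fill_mem`): by the Chinese remainder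
  theorem some shift of `base` agrees with it on a given finite window.
* The subshift is irregular (`not_isRegular_toeplitzSubshift`): filling with the constant `1`
  carries the uniform distribution of the odometer to an invariant measure, and the result is not
  a Toeplitz sequence when position `0` is never written, an event of probability at least `1 - 1
  / 32`.
* Filling with the sign of the Möbius function gives strongly correlated points
  (`eventually_le_corrAvg`): at a squarefree position that is never written the product with the
  Möbius function is `1`. The squarefree numbers have lower density at least `1 / 4`, and the
  written positions are few if all residue classes from some stage on are those of the multiples
  of the period. As finitely many coordinates of `ω` remain free, such points are dense.
* The averages of these points are eventually at least `1 / 8`, a bound independent of the point.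
  The points with infinitely many averages above `1 / 16` therefore form a dense `G_δ` set, and
  all of them are weakly correlated with the Möbius function
  (`frequently_lt_corrAvg_mem_residual`).
-/

noncomputable section

namespace ToeplitzMoebius

/-! ### The construction -/

/-- The letter `1`. -/
def plus : Sign := ⟨1, by simp⟩

/-- The letter `-1`. -/
def minus : Sign := ⟨-1, by simp⟩

lemma minus_ne_plus : minus ≠ plus := by
  simp [minus, plus, Subtype.ext_iff]

lemma eq_plus_or_eq_minus (v : Sign) : v = plus ∨ v = minus := by
  obtain ⟨v, hv⟩ := v
  rcases hv with rfl | hv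
  · exact Or.inr rfl
  · rw [Set.mem_singleton_iff] at hv
    subst hv
    exact Or.inl rfl

/-- The period used at stage `j`. Any pairwise coprime periods with a small sum of reciprocals would
do; Fermat numbers are a ready supply, and the offset `6` makes that sum at most `1 / 32`. -/
def period (j : ℕ) : ℕ := Nat.fermatNumber (j + 6)

/-- The centers run through all integers, so that every position is filled eventually. -/
def center (j : ℕ) : ℤ := Equiv.intEquivNat.symm j

/-- The letter written at stage `j`; each letter is written at infinitely many stages. -/
def letter (j : ℕ) : Sign := if Even j then plus else minus

lemma two_pow_lt_period (j : ℕ) : 2 ^ (j + 6) < period j := by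
  rw [period, Nat.fermatNumber, Nat.lt_succ_iff]
  exact Nat.pow_le_pow_right two_pos Nat.lt_two_pow_self.le

lemma lt_period (j : ℕ) : j < period j := by
  have h1 := two_pow_lt_period j
  have h2 : j + 6 < 2 ^ (j + 6) := Nat.lt_two_pow_self
  omega

lemma period_pos (j : ℕ) : 0 < period j := (Nat.zero_le j).trans_lt (lt_period j)

instance (j : ℕ) : NeZero (period j) := ⟨(period_pos j).ne'⟩

lemma period_coprime : Pairwise fun i j => (period i).Coprime (period j) := fun i j hij =>
  Nat.pairwise_coprime_fermatNumber (fun h => hij (by omega))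

/-- All prime factors of `period j` are large. -/
lemma period_coprime_of_le {p j : ℕ} (hp : 0 < p) (hj : p ≤ j) : p.Coprime (period j) := by
  refine Nat.coprime_of_dvd fun q hq hqp hqj => ?_
  obtain ⟨k, hk⟩ := Nat.fermat_primeFactors_one_lt (j + 6) q (by omega) hq hqj
  have hk0 : 0 < k := by
    rcases Nat.eq_zero_or_pos k with rfl | h
    · exact absurd hq (by simp [hk, Nat.not_prime_one])
    · exact h
  have h1 := Nat.le_of_dvd hp hqp
  have h2 : j + 6 + 2 < 2 ^ (j + 6 + 2) := Nat.lt_two_pow_self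
  have h3 : 2 ^ (j + 6 + 2) ≤ k * 2 ^ (j + 6 + 2) := Nat.le_mul_of_pos_left _ hk0
  omega

/-- The odometer on which the construction is based. An integer `k` embeds as the constant
family `fun _ => k`. -/
abbrev Odometer : Type := ∀ j : ℕ, ZMod (period j)

lemma exists_int_eq_on (M : ℕ) (r : Odometer) : ∃ k : ℤ, ∀ j < M, (k : ZMod (period j)) = r j := by
  obtain ⟨k, hk⟩ := Nat.chineseRemainderOfFinset (fun j => (r j).val) period (Finset.range M)
    (fun j _ => (period_pos j).ne') (fun i _ j _ hij => period_coprime hij)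
  refine ⟨k, fun j hj => ?_⟩
  have h := (ZMod.natCast_eq_natCast_iff _ _ _).2 (hk j (Finset.mem_range.2 hj))
  simpa using h

/-- Stage `j` writes at position `n` of the sequence with odometer coordinate `ω`. -/
def Hit (ω : Odometer) (n : ℤ) (j : ℕ) : Prop := (n : ZMod (period j)) + ω j = center j

open Classical in
/-- The sequence with odometer coordinate `ω` in which position `n` carries the letter of the first
stage that writes there, and the letter `b n` if no stage does. -/
def fill (ω : Odometer) (b : ℤ → Sign) (n : ℤ) : Sign :=
  if h : ∃ j, Hit ω n j then letter (Nat.find h) else b n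

lemma fill_of_hit {ω : Odometer} {n : ℤ} {j : ℕ} (b : ℤ → Sign) (h : Hit ω n j)
    (hlt : ∀ i < j, ¬ Hit ω n i) : fill ω b n = letter j := by
  classical
  have hex : ∃ j, Hit ω n j := ⟨j, h⟩
  rw [fill, dif_pos hex, (Nat.find_eq_iff hex).2 ⟨h, hlt⟩]

lemma fill_of_not_hit {ω : Odometer} {n : ℤ} (b : ℤ → Sign) (h : ∀ j, ¬ Hit ω n j) :
    fill ω b n = b n := by
  rw [fill, dif_neg (by simpa using h)]

lemma exists_first_hit {ω : Odometer} {n : ℤ} {j : ℕ} (h : Hit ω n j) :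
    ∃ i ≤ j, Hit ω n i ∧ ∀ l < i, ¬ Hit ω n l := by
  classical
  have hex : ∃ j, Hit ω n j := ⟨j, h⟩
  exact ⟨Nat.find hex, Nat.find_min' hex h, Nat.find_spec hex, fun l hl => Nat.find_min hex hl⟩

/-- Only the stages up to `j` matter at a position where stage `j` writes. -/
lemma fill_congr {ω ω' : Odometer} {n n' : ℤ} {j : ℕ} (b b' : ℤ → Sign) (h : Hit ω n j)
    (hiff : ∀ i ≤ j, (Hit ω n i ↔ Hit ω' n' i)) : fill ω b n = fill ω' b' n' := by
  obtain ⟨i, hij, hi, hlt⟩ := exists_first_hit h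
  rw [fill_of_hit b hi hlt, fill_of_hit b' ((hiff i hij).1 hi)
    fun l hl => (hiff l (hl.le.trans hij)).not.1 (hlt l hl)]

/-- Shifting a sequence rotates its odometer coordinate. -/
lemma hit_add_iff (ω : Odometer) (k n : ℤ) (j : ℕ) :
    Hit ω (k + n) j ↔ Hit (fun i => ω i + k) n j := by
  simp only [Hit, Int.cast_add]
  rw [add_comm (k : ZMod (period j)), add_assoc, add_comm (k : ZMod (period j))]

lemma shift_fill (ω : Odometer) (b : ℤ → Sign) (k : ℤ) :
    shift k (fill ω b) = fill (fun i => ω i + k) (shift k b) := by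
  funext n
  by_cases h : ∃ j, Hit ω (k + n) j
  · obtain ⟨j, hj⟩ := h
    exact fill_congr b _ hj fun i _ => hit_add_iff ω k n i
  · push Not at h
    rw [shift_apply, fill_of_not_hit b h,
      fill_of_not_hit _ fun j => (hit_add_iff ω k n j).not.1 (h j), shift_apply]

/-- The Toeplitz sequence generating the subshift. Every position is written at some stage, so the
filling is immaterial. -/
def base : ℤ → Sign := fill (fun _ => 0) fun _ => plus

lemma exists_hit_zero (n : ℤ) : ∃ j, Hit (fun _ => 0) n j :=
  ⟨Equiv.intEquivNat n, by simp [Hit, center]⟩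

lemma isToeplitzSeq_base : IsToeplitzSeq base := by
  intro n
  obtain ⟨j, hj⟩ := exists_hit_zero n
  refine ⟨∏ i ∈ Finset.range (j + 1), period i, Finset.prod_pos fun i _ => period_pos i,
    fun m => fill_congr _ _ hj fun i hi => ?_⟩
  have h0 : ((∏ l ∈ Finset.range (j + 1), period l : ℕ) : ZMod (period i)) = 0 := by
    rw [ZMod.natCast_eq_zero_iff]
    exact Finset.dvd_prod_of_mem _ (Finset.mem_range.2 (Nat.lt_succ_of_le hi))
  simp only [Hit, Int.cast_add, Int.cast_mul, Int.cast_natCast, h0, mul_zero, add_zero]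

/-- The subshift generated by `base`. -/
def toeplitzSubshift : Subshift Sign ℤ where
  carrier := closure (Set.range fun k : ℤ => shift k base)
  isClosed := isClosed_closure
  mapsTo g := by
    refine Set.MapsTo.closure ?_ (continuous_shift g)
    rintro _ ⟨k, rfl⟩
    exact ⟨k + g, shift_add k g base⟩

lemma mem_closure_of_forall_finset {S : Set (ℤ → Sign)} {y : ℤ → Sign}
    (h : ∀ U : Finset ℤ, ∃ x ∈ S, ∀ n ∈ U, x n = y n) : y ∈ closure S := by
  rw [mem_closure_iff]
  intro O hO hy
  obtain ⟨U, u, hu, hUO⟩ := isOpen_pi_iff.1 hO y hy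
  obtain ⟨x, hxS, hx⟩ := h U
  exact ⟨x, hUO fun n hn => (hx n hn).symm ▸ (hu n hn).2, hxS⟩

/-! ### The points of the subshift -/

/-- A coordinate at stage `j` for which that stage writes, inside the window `U`, only at the
position to which `g` assigns it, and only if this position satisfies `P`. -/
lemma exists_stage_coordinate (U : Finset ℤ) (g : ℤ → ℕ) (P : ℤ → Prop)
    (hg : Function.Injective g) {j : ℕ}
    (hcard : U.card < period j) (hinj : ∀ m ∈ U, ∀ n ∈ U,
      (m : ZMod (period j)) = n → m = n) :
    ∃ r : ZMod (period j), ∀ n ∈ U, ((n : ZMod (period j)) + r = center j ↔ P n ∧ g n = j) := by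
  by_cases h : ∃ m ∈ U, P m ∧ g m = j
  · obtain ⟨m, hm, hPm, hgm⟩ := h
    refine ⟨center j - m, fun n hn => ⟨fun h => ?_, fun h => ?_⟩⟩
    · have : n = m := hinj n hn m hm (by linear_combination h)
      exact this ▸ ⟨hPm, hgm⟩
    · rw [hg (h.2.trans hgm.symm)]
      ring
  · push Not at h
    -- some residue is not excluded by any position of `U`
    obtain ⟨r, hr⟩ : ∃ r, r ∉ U.image fun n : ℤ => (center j : ZMod (period j)) - n := by
      by_contra! hall
      have h1 : Finset.univ ⊆ U.image fun n : ℤ => (center j : ZMod (period j)) - n :=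
        fun r _ => hall r
      have h2 := (Finset.card_le_card h1).trans Finset.card_image_le
      rw [Finset.card_univ, ZMod.card] at h2
      omega
    refine ⟨r, fun n hn => ⟨fun h' => ?_, fun h' => absurd h'.2 (h n hn h'.1)⟩⟩
    exact absurd (Finset.mem_image.2 ⟨n, hn, by linear_combination -h'⟩) hr

/-- The subshift contains every filling of every odometer coordinate: for a finite window, the
stages deciding the written positions are prescribed by the Chinese remainder theorem, and each
remaining position is served by a later stage of its own that carries the wanted letter. -/
theorem fill_mem (ω : Odometer) (b : ℤ → Sign) : fill ω b ∈ toeplitzSubshift.carrier := by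
  refine mem_closure_of_forall_finset fun U => ?_
  -- the stages from `J` on are free: written positions are decided earlier, and the window has
  -- distinct residues modulo the later periods
  obtain ⟨J, hJhit, hJcard, hJabs⟩ : ∃ J : ℕ,
      (∀ n ∈ U, (∃ j, Hit ω n j) → ∃ j < J, Hit ω n j) ∧ U.card ≤ J ∧
      ∀ m ∈ U, ∀ n ∈ U, |m - n| ≤ J := by
    have h1 : ∀ n : ℤ, ∃ J : ℕ, (∃ j, Hit ω n j) → ∃ j < J, Hit ω n j := fun n => by
      by_cases h : ∃ j, Hit ω n j
      · obtain ⟨j, hj⟩ := h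
        exact ⟨j + 1, fun _ => ⟨j, j.lt_succ_self, hj⟩⟩
      · exact ⟨0, fun h' => absurd h' h⟩
    choose J₁ hJ₁ using h1
    refine ⟨U.sup J₁ + U.card + (U ×ˢ U).sup fun q => (q.1 - q.2).natAbs,
      fun n hn h => ?_, by omega, fun m hm n hn => ?_⟩
    · obtain ⟨j, hj, hj'⟩ := hJ₁ n h
      have := Finset.le_sup (f := J₁) hn
      exact ⟨j, by omega, hj'⟩
    · have := Finset.le_sup (f := fun q : ℤ × ℤ => (q.1 - q.2).natAbs)
        (Finset.mk_mem_product hm hn)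
      dsimp only at this
      rw [Int.abs_eq_natAbs]
      omega
  -- the stage reserved for position `n`; its parity selects the letter
  let g : ℤ → ℕ := fun n => 2 * (J + Equiv.intEquivNat n) + if b n = plus then 0 else 1
  have hginj : Function.Injective g := fun m n h => by
    refine Equiv.intEquivNat.injective ?_
    dsimp only [g] at h
    split_ifs at h <;> omega
  have hgJ : ∀ n, J ≤ g n := fun n => by dsimp only [g]; omega
  have hgletter : ∀ n, letter (g n) = b n := fun n => by
    dsimp only [g, letter]
    split_ifs with h1 h2 h2
    · exact h1.symm
    · exact absurd h2 (by simp)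
    · exact absurd h2 (by simp)
    · exact ((eq_plus_or_eq_minus (b n)).resolve_left h1).symm
  have hr : ∀ j, ∃ r : ZMod (period j), (j < J → r = ω j) ∧ (J ≤ j → ∀ n ∈ U,
      ((n : ZMod (period j)) + r = center j ↔ (∀ i, ¬ Hit ω n i) ∧ g n = j)) := fun j => by
    rcases lt_or_ge j J with hj | hj
    · exact ⟨ω j, fun _ => rfl, fun h => absurd hj h.not_gt⟩
    · have hp := lt_period j
      obtain ⟨r, hr⟩ := exists_stage_coordinate U g (fun n => ∀ i, ¬ Hit ω n i) hginj (j := j)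
        (by omega) fun m hm n hn h => by
          have hdvd := (ZMod.intCast_eq_intCast_iff_dvd_sub n m _).1 h.symm
          have habs := hJabs m hm n hn
          have := Int.eq_zero_of_abs_lt_dvd hdvd (by omega)
          omega
      exact ⟨r, fun h => absurd hj h.not_ge, fun _ => hr⟩
  choose r hrlt hrge using hr
  obtain ⟨k, hk⟩ := exists_int_eq_on (J + U.sup g + 1) r
  have hkr : ∀ n : ℤ, ∀ j < J + U.sup g + 1, (Hit (fun _ => 0) (k + n) j ↔ Hit r n j) := by
    intro n j hj
    rw [hit_add_iff, Hit, Hit, ← hk j hj, zero_add]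
  have hrω : ∀ n : ℤ, ∀ j < J, (Hit r n j ↔ Hit ω n j) := fun n j hj => by
    rw [Hit, Hit, hrlt j hj]
  refine ⟨shift k base, ⟨k, rfl⟩, fun n hn => ?_⟩
  rw [shift_apply, base]
  by_cases h : ∃ j, Hit ω n j
  · obtain ⟨j, hj, hj'⟩ := hJhit n hn h
    refine (fill_congr _ _ hj' fun i hi => ?_).symm
    rw [hkr n i (by omega), hrω n i (by omega)]
  · push Not at h
    have hgle := Finset.le_sup (f := g) hn
    rw [fill_of_not_hit b h, ← hgletter n]
    refine fill_of_hit _ ((hkr n _ (by omega)).2 ((hrge _ (hgJ n) n hn).2 ⟨h, rfl⟩)) fun i hi => ?_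
    rw [hkr n i (by omega)]
    rcases lt_or_ge i J with hiJ | hiJ
    · rw [hrω n i hiJ]
      exact h i
    · exact fun hh => hi.ne ((hrge i hiJ n hn).1 hh).2.symm

/-! ### Irregularity -/

/-- If no stage writes at position `0`, then filling with `1` does not give a Toeplitz sequence:
along any progression `pℤ`, a late stage with the letter `-1` is the first to write somewhere. -/
lemma not_isToeplitzSeq_fill {ω : Odometer} (h : ∀ j, ¬ Hit ω 0 j) :
    ¬ IsToeplitzSeq (fill ω fun _ => plus) := by
  intro hT
  obtain ⟨p, hp, hper⟩ := hT 0
  let j := 2 * p + 1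
  let r : Odometer := fun i => if i = j then (p : ZMod (period i))⁻¹ * (center i - ω i) else 0
  obtain ⟨m, hm⟩ := exists_int_eq_on (j + 1) r
  have hval : fill ω (fun _ => plus) (0 + m * p) = letter j := by
    refine fill_of_hit _ ?_ fun i hi => ?_
    · have hmj := hm j (by omega)
      simp only [r, if_true] at hmj
      have hinv := ZMod.coe_mul_inv_eq_one p (period_coprime_of_le hp (show p ≤ j by omega))
      simp only [Hit, Int.cast_add, Int.cast_zero, Int.cast_mul, Int.cast_natCast]
      rw [hmj]
      linear_combination (center j - ω j) * hinv
    · have hmi := hm i (by omega)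
      simp only [r, if_neg hi.ne] at hmi
      have hi0 := h i
      simp only [Hit, Int.cast_add, Int.cast_zero, Int.cast_mul, Int.cast_natCast] at hi0 ⊢
      rwa [hmi, zero_mul, zero_add]
  have h1 := hper m
  rw [hval, fill_of_not_hit _ h, letter, if_neg (by simp [j])] at h1
  exact minus_ne_plus h1.symm

/-- The uniform distribution on the odometer. -/
def odometerMeasure : Measure Odometer :=
  Measure.infinitePi fun j => (PMF.uniformOfFintype (ZMod (period j))).toMeasure

instance : IsProbabilityMeasure odometerMeasure := by
  rw [odometerMeasure]; infer_instance

lemma map_add_uniform (j : ℕ) (c : ZMod (period j)) :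
    (PMF.uniformOfFintype (ZMod (period j))).toMeasure.map (fun r => r + c) =
      (PMF.uniformOfFintype (ZMod (period j))).toMeasure := by
  refine Measure.ext_of_singleton fun v => ?_
  have h : (fun r : ZMod (period j) => r + c) ⁻¹' {v} = {v - c} := by
    ext r
    simp only [Set.mem_preimage, Set.mem_singleton_iff]
    exact eq_sub_iff_add_eq.symm
  rw [Measure.map_apply (measurable_of_countable _) (.singleton v), h,
    PMF.toMeasure_apply_singleton _ _ (.singleton _),
    PMF.toMeasure_apply_singleton _ _ (.singleton _)]
  simp

lemma measurePreserving_odometer :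
    MeasurePreserving (fun ω : Odometer => fun j => ω j + ((1 : ℤ) : ZMod (period j)))
      odometerMeasure odometerMeasure := by
  refine ⟨measurable_pi_lambda _ fun j =>
    (measurable_of_countable fun r : ZMod (period j) => r + ((1 : ℤ) : ZMod (period j))).comp
      (measurable_pi_apply j), ?_⟩
  rw [odometerMeasure, Measure.infinitePi_map_pi _
    (f := fun j (r : ZMod (period j)) => r + ((1 : ℤ) : ZMod (period j)))
    fun j => measurable_of_countable _]
  simp_rw [map_add_uniform]

lemma measurable_hit (n : ℤ) (j : ℕ) : Measurable fun ω : Odometer => Hit ω n j :=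
  (measurable_of_countable fun r : ZMod (period j) =>
    (n : ZMod (period j)) + r = center j).comp (measurable_pi_apply j)

lemma odometerMeasure_hit (n : ℤ) (j : ℕ) :
    odometerMeasure {ω | Hit ω n j} = (period j : ENNReal)⁻¹ := by
  have h : {ω : Odometer | Hit ω n j} =
      (fun ω : Odometer => ω j) ⁻¹' {(center j : ZMod (period j)) - n} := by
    ext ω
    simp only [Hit, Set.mem_ofPred_eq, Set.mem_preimage, Set.mem_singleton_iff]
    rw [eq_sub_iff_add_eq, add_comm]
  rw [h, ← Measure.map_apply (measurable_pi_apply j) (.singleton _), odometerMeasure,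
    Measure.infinitePi_map_eval, PMF.toMeasure_apply_singleton _ _ (.singleton _)]
  simp

lemma inv_period_le (j : ℕ) : (period j : ℝ)⁻¹ ≤ 1 / 64 * (1 / 2) ^ j := by
  have h : ((2 : ℝ) ^ (j + 6)) ≤ period j := by exact_mod_cast (two_pow_lt_period j).le
  calc (period j : ℝ)⁻¹ ≤ ((2 : ℝ) ^ (j + 6))⁻¹ := inv_anti₀ (by positivity) h
    _ = 1 / 64 * (1 / 2) ^ j := by rw [pow_add, mul_inv, one_div_pow]; norm_num; ring

lemma sum_inv_period_le (M : ℕ) : ∑ j ∈ Finset.range M, (period j : ℝ)⁻¹ ≤ 1 / 32 := by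
  calc ∑ j ∈ Finset.range M, (period j : ℝ)⁻¹
      ≤ ∑ j ∈ Finset.range M, 1 / 64 * (1 / 2 : ℝ) ^ j :=
        Finset.sum_le_sum fun j _ => inv_period_le j
    _ = 1 / 64 * ∑ j ∈ Finset.range M, (1 / 2 : ℝ) ^ j := by rw [Finset.mul_sum]
    _ ≤ 1 / 64 * 2 := by gcongr; exact sum_geometric_two_le M
    _ = 1 / 32 := by norm_num

lemma odometerMeasure_exists_hit_lt_one (n : ℤ) :
    odometerMeasure {ω | ∃ j, Hit ω n j} < 1 := by
  have h1 : {ω : Odometer | ∃ j, Hit ω n j} = ⋃ j, {ω | Hit ω n j} := by ext; simp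
  have h2 : ∑' j, (period j : ENNReal)⁻¹ ≤ ENNReal.ofReal (1 / 32) := by
    refine ENNReal.tsum_le_of_sum_range_le fun M => ?_
    have h3 : ∀ j, (period j : ENNReal)⁻¹ = ENNReal.ofReal (period j : ℝ)⁻¹ := fun j => by
      rw [ENNReal.ofReal_inv_of_pos (by exact_mod_cast period_pos j), ENNReal.ofReal_natCast]
    simp_rw [h3]
    rw [← ENNReal.ofReal_sum_of_nonneg fun j _ => by positivity]
    exact ENNReal.ofReal_le_ofReal (sum_inv_period_le M)
  calc odometerMeasure {ω | ∃ j, Hit ω n j}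
      ≤ ∑' j, odometerMeasure {ω | Hit ω n j} := h1 ▸ measure_iUnion_le _
    _ = ∑' j, (period j : ENNReal)⁻¹ := by simp_rw [odometerMeasure_hit]
    _ ≤ ENNReal.ofReal (1 / 32) := h2
    _ < 1 := by rw [ENNReal.ofReal_lt_one]; norm_num

lemma measurable_fill (b : ℤ → Sign) : Measurable fun ω => fill ω b := by
  refine measurable_pi_lambda _ fun n => measurable_to_countable' fun v => ?_
  have h : (fun ω => fill ω b n) ⁻¹' {v} =
      (⋃ j, {ω : Odometer | Hit ω n j ∧ (∀ i, i < j → ¬ Hit ω n i) ∧ letter j = v}) ∪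
        {ω | (∀ j, ¬ Hit ω n j) ∧ b n = v} := by
    ext ω
    simp only [Set.mem_preimage, Set.mem_singleton_iff, Set.mem_union, Set.mem_iUnion,
      Set.mem_ofPred_eq]
    constructor
    · rintro rfl
      by_cases hex : ∃ j, Hit ω n j
      · obtain ⟨j, hj⟩ := hex
        obtain ⟨i, -, hi, hlt⟩ := exists_first_hit hj
        exact Or.inl ⟨i, hi, hlt, (fill_of_hit b hi hlt).symm⟩
      · push Not at hex
        exact Or.inr ⟨hex, (fill_of_not_hit b hex).symm⟩
    · rintro (⟨j, hj, hlt, rfl⟩ | ⟨hno, rfl⟩)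
      · exact fill_of_hit b hj hlt
      · exact fill_of_not_hit b hno
  rw [h]
  refine .union (.iUnion fun j => measurableSet_setOfPred.2 ((measurable_hit n j).and
    (.and ?_ measurable_const))) (measurableSet_setOfPred.2 (.and ?_ measurable_const))
  · exact .forall fun i => .imp measurable_const (measurable_hit n i).not
  · exact .forall fun i => (measurable_hit n i).not

/-- Filling the unwritten positions with `1` transports the uniform distribution on the odometer to
an invariant measure on the subshift that charges the sequences that are not Toeplitz. -/
theorem not_isRegular_toeplitzSubshift : ¬ IsRegular toeplitzSubshift := by
  intro hreg
  let f : Odometer → ℤ → Sign := fun ω => fill ω fun _ => plus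
  have hf : Measurable f := measurable_fill _
  have hshift : Measurable (shift (1 : ℤ) : (ℤ → Sign) → ℤ → Sign) :=
    measurable_pi_lambda _ fun n => measurable_pi_apply (1 + n)
  have hinv : MeasurePreserving (shift (1 : ℤ)) (odometerMeasure.map f)
      (odometerMeasure.map f) := by
    refine ⟨hshift, ?_⟩
    have hcomm : shift (1 : ℤ) ∘ f =
        f ∘ fun ω : Odometer => fun j => ω j + ((1 : ℤ) : ZMod (period j)) :=
      funext fun ω => shift_fill ω _ 1
    rw [Measure.map_map hshift hf, hcomm,
      ← Measure.map_map hf measurePreserving_odometer.measurable, measurePreserving_odometer.map_eq]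
  have hX : ∀ᵐ x ∂odometerMeasure.map f, x ∈ toeplitzSubshift.carrier :=
    (ae_map_iff hf.aemeasurable toeplitzSubshift.isClosed.measurableSet).2
      (.of_forall fun ω => fill_mem ω _)
  have hae := ae_of_ae_map hf.aemeasurable
    (hreg _ (Measure.isProbabilityMeasure_map hf.aemeasurable) hinv hX)
  have hhit : ∀ᵐ ω ∂odometerMeasure, ∃ j, Hit ω 0 j := by
    filter_upwards [hae] with ω hω
    by_contra h
    exact not_isToeplitzSeq_fill (by simpa using h) hω
  exact (odometerMeasure_exists_hit_lt_one 0).ne ((measure_congr (eventuallyEq_univ.2 hhit)).trans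
    measure_univ)

/-! ### Correlation with the Möbius function -/

lemma sum_inv_sq_le (M : ℕ) :
    ∑ d ∈ Finset.Ico 2 (M + 3), (1 : ℝ) / (d : ℝ) ^ 2 ≤ 3 / 4 - 1 / (M + 2) := by
  induction M with
  | zero => norm_num
  | succ M ih =>
    rw [Finset.sum_Ico_succ_top (by omega)]
    have h : (1 : ℝ) / ((M + 3 : ℕ) : ℝ) ^ 2 ≤ 1 / (M + 2) - 1 / (M + 3) := by
      rw [div_sub_div _ _ (by positivity) (by positivity),
        div_le_div_iff₀ (by positivity) (by positivity)]
      push_cast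
      nlinarith
    rw [show M + 1 + 2 = M + 3 by ring]
    push_cast at h ⊢
    rw [show (M : ℝ) + 1 + 2 = M + 3 by ring]
    linarith

open Classical in
/-- A nonsquarefree number is divisible by `d ^ 2` for some `d ≥ 2`, and the sum of `1 / d ^ 2` over
`d ≥ 2` is at most `3 / 4`. -/
lemma div_four_le_card_squarefree (N : ℕ) :
    (N : ℝ) / 4 ≤ ((Finset.Ioc 0 N).filter Squarefree).card := by
  have hsub : (Finset.Ioc 0 N).filter (fun n => ¬ Squarefree n) ⊆
      (Finset.Ico 2 (N + 3)).biUnion fun d => (Finset.Ioc 0 N).filter fun n => d ^ 2 ∣ n := by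
    intro n hn
    simp only [Finset.mem_filter, Finset.mem_biUnion, Finset.mem_Ico, Finset.mem_Ioc] at hn ⊢
    obtain ⟨⟨h1, h2⟩, hsq⟩ := hn
    rw [Nat.squarefree_iff_prime_squarefree] at hsq
    push Not at hsq
    obtain ⟨q, hq, hqn⟩ := hsq
    have := Nat.le_of_dvd (by omega) hqn
    have := Nat.le_mul_self q
    exact ⟨q, ⟨hq.two_le, by omega⟩, ⟨by omega, h2⟩, by rwa [pow_two]⟩
  have hcard : (((Finset.Ioc 0 N).filter fun n => ¬ Squarefree n).card : ℝ) ≤ N * (3 / 4) :=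
    calc (((Finset.Ioc 0 N).filter fun n => ¬ Squarefree n).card : ℝ)
        ≤ ∑ d ∈ Finset.Ico 2 (N + 3), (((Finset.Ioc 0 N).filter fun n => d ^ 2 ∣ n).card : ℝ) := by
          exact_mod_cast (Finset.card_le_card hsub).trans Finset.card_biUnion_le
      _ ≤ ∑ d ∈ Finset.Ico 2 (N + 3), (N : ℝ) * (1 / (d : ℝ) ^ 2) := by
          refine Finset.sum_le_sum fun d _ => ?_
          rw [Nat.Ioc_filter_dvd_card_eq_div, mul_one_div]
          exact_mod_cast Nat.cast_div_le (α := ℝ) (m := N) (n := d ^ 2)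
      _ ≤ N * (3 / 4) := by
          rw [← Finset.mul_sum]
          gcongr
          have := sum_inv_sq_le N
          have : (0 : ℝ) ≤ 1 / (N + 2) := by positivity
          linarith
  have htot : (((Finset.Ioc 0 N).filter Squarefree).card : ℝ) +
      ((Finset.Ioc 0 N).filter fun n => ¬ Squarefree n).card = N := by
    have := Finset.card_filter_add_card_filter_not (s := Finset.Ioc 0 N) (p := Squarefree)
    rw [Nat.card_Ioc, Nat.sub_zero] at this
    exact_mod_cast this
  linarith

open Classical in
lemma card_hit_le (ω : Odometer) (j N : ℕ) :
    (((Finset.Ioc 0 N).filter fun i : ℕ => Hit ω i j).card : ℝ) ≤ N * (period j : ℝ)⁻¹ + 1 := by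
  have hp : (0 : ℝ) < period j := by exact_mod_cast period_pos j
  let c : ZMod (period j) := center j - ω j
  have hiff : ∀ i : ℕ, Hit ω i j ↔ i ≡ c.val [MOD period j] := fun i => by
    rw [← ZMod.natCast_eq_natCast_iff, ZMod.natCast_zmod_val, eq_sub_iff_add_eq, Hit,
      Int.cast_natCast]
  simp_rw [hiff]
  have h := Nat.Ioc_filter_modEq_card 0 N (period_pos j) c.val
  have hQ : (0 : ℚ) < period j := by exact_mod_cast period_pos j
  have h1 := Int.floor_le (((N : ℚ) - c.val) / period j)
  have h2 := Int.lt_floor_add_one (((0 : ℕ) - c.val : ℚ) / period j)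
  rw [sub_div] at h1 h2
  have hmax : ((((Finset.Ioc 0 N).filter fun i : ℕ => i ≡ c.val [MOD period j]).card : ℤ) : ℚ) ≤
      N * (period j : ℚ)⁻¹ + 1 := by
    rw [h, Int.cast_max, ← div_eq_mul_inv]
    refine max_le ?_ (by rw [Int.cast_zero]; positivity)
    push_cast [sub_div] at h1 h2 ⊢
    rw [zero_div] at h2 ⊢
    linarith
  have hreal := (Rat.cast_le (K := ℝ)).2 hmax
  push_cast at hreal
  convert hreal

open Classical in
/-- If every stage from `J` on writes at position `0`, then these stages write exactly at the
multiples of their periods. Hence they contribute no rounding error, and the positions from `1` to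
`N` are written by the first `J + N` stages only. -/
lemma card_exists_hit_le {ω : Odometer} {J : ℕ} (hω : ∀ j, J ≤ j → ω j = center j) (N : ℕ) :
    (((Finset.Ioc 0 N).filter fun i : ℕ => ∃ j, Hit ω i j).card : ℝ) ≤ N / 32 + J := by
  have hlate : ∀ j, J ≤ j → ∀ i : ℕ, Hit ω i j ↔ period j ∣ i := fun j hj i => by
    rw [Hit, hω j hj, add_eq_right, Int.cast_natCast, ZMod.natCast_eq_zero_iff]
  have hsub : (Finset.Ioc 0 N).filter (fun i : ℕ => ∃ j, Hit ω i j) ⊆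
      (Finset.range (J + N)).biUnion fun j => (Finset.Ioc 0 N).filter fun i : ℕ => Hit ω i j := by
    intro i hi
    simp only [Finset.mem_filter, Finset.mem_biUnion, Finset.mem_range, Finset.mem_Ioc] at hi ⊢
    obtain ⟨hiN, j, hj⟩ := hi
    refine ⟨j, ?_, hiN, hj⟩
    by_contra hlt
    have h1 := Nat.le_of_dvd hiN.1 ((hlate j (by omega) i).1 hj)
    have h2 := lt_period j
    omega
  calc (((Finset.Ioc 0 N).filter fun i : ℕ => ∃ j, Hit ω i j).card : ℝ)
      ≤ ∑ j ∈ Finset.range (J + N),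
          (((Finset.Ioc 0 N).filter fun i : ℕ => Hit ω i j).card : ℝ) := by
        exact_mod_cast (Finset.card_le_card hsub).trans Finset.card_biUnion_le
    _ ≤ ∑ j ∈ Finset.range (J + N), ((N : ℝ) * (period j : ℝ)⁻¹ + if j < J then 1 else 0) := by
        refine Finset.sum_le_sum fun j _ => ?_
        split_ifs with hj
        · exact card_hit_le ω j N
        · simp_rw [hlate j (not_lt.1 hj)]
          rw [Nat.Ioc_filter_dvd_card_eq_div, add_zero, ← div_eq_mul_inv]
          exact Nat.cast_div_le
    _ = N * ∑ j ∈ Finset.range (J + N), (period j : ℝ)⁻¹ + J := by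
        rw [Finset.sum_add_distrib, ← Finset.mul_sum, Finset.sum_ite, Finset.sum_const_zero,
          add_zero, Finset.sum_const, nsmul_one]
        congr 3
        have : (Finset.range (J + N)).filter (· < J) = Finset.range J := by
          ext j
          simp only [Finset.mem_filter, Finset.mem_range]
          omega
        rw [this, Finset.card_range]
    _ ≤ N * (1 / 32) + J := by gcongr; exact sum_inv_period_le _
    _ = N / 32 + J := by ring

/-- The sign of the Möbius function, with the value `1` where the function vanishes. -/
def moebiusSign (n : ℤ) : Sign := if 0 ≤ mu n.toNat then plus else minus

lemma abs_mu_le_one (n : ℕ) : |mu n| ≤ 1 := by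
  rw [mu]
  exact_mod_cast ArithmeticFunction.abs_moebius_le_one

lemma fwd_eq_one_or (x : ℤ → Sign) (n : ℕ) : fwd x n = 1 ∨ fwd x n = -1 := by
  rcases eq_plus_or_eq_minus (x n) with h | h <;> simp [fwd, h, plus, minus]

lemma abs_fwd_mul_mu_le_one (x : ℤ → Sign) (n : ℕ) : |fwd x n * mu n| ≤ 1 := by
  rw [abs_mul]
  rcases fwd_eq_one_or x n with h | h <;> simpa [h] using abs_mu_le_one n

open Classical in
lemma indicator_sub_le_fwd_fill_mul_mu (ω : Odometer) (i : ℕ) :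
    (if Squarefree i then 1 else 0) - 2 * (if ∃ j, Hit ω i j then 1 else 0) ≤
      fwd (fill ω moebiusSign) i * mu i := by
  have hle : (if Squarefree i then (1 : ℝ) else 0) ≤ |mu i| := by
    split_ifs with h
    · rw [mu]
      exact_mod_cast (ArithmeticFunction.abs_moebius_eq_one_of_squarefree h).ge
    · exact abs_nonneg _
  by_cases h : ∃ j, Hit ω i j
  · rw [if_pos h]
    have h1 := abs_le.1 (abs_fwd_mul_mu_le_one (fill ω moebiusSign) i)
    have h2 := abs_mu_le_one i
    linarith [h1.1]
  · rw [if_neg h]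
    push Not at h
    have hsign : fwd (fill ω moebiusSign) i * mu i = |mu i| := by
      rw [fwd, fill_of_not_hit _ h, moebiusSign, Int.toNat_natCast]
      split_ifs with h0
      · simp [plus, abs_of_nonneg h0]
      · simp [minus, abs_of_neg (not_le.1 h0)]
    rw [hsign]
    linarith

/-- When the unwritten positions carry the sign of the Möbius function, the squarefree positions,
of density at least `1 / 4`, outweigh the written ones, of density at most `1 / 32`. -/
lemma eventually_le_corrAvg {ω : Odometer} {J : ℕ} (hω : ∀ j, J ≤ j → ω j = center j) :
    ∀ᶠ N in atTop, 1 / 8 ≤ corrAvg (fwd (fill ω moebiusSign)) mu N := by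
  classical
  filter_upwards [eventually_ge_atTop (32 * J + 1)] with N hN
  have hN' : (32 * J + 1 : ℝ) ≤ N := by exact_mod_cast hN
  have hJ0 : (0 : ℝ) ≤ J := J.cast_nonneg
  have hsum := Finset.sum_le_sum fun i (_ : i ∈ Finset.Ioc 0 N) =>
    indicator_sub_le_fwd_fill_mul_mu ω i
  rw [Finset.sum_sub_distrib, ← Finset.mul_sum, Finset.sum_boole, Finset.sum_boole] at hsum
  have h1 := div_four_le_card_squarefree N
  have h2 := card_exists_hit_le hω N
  rw [corrAvg, one_div_mul_eq_div, le_div_iff₀ (by linarith)]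
  change _ ≤ ∑ i ∈ Finset.Ioc 0 N, _
  linarith

lemma abs_corrAvg_le_one (x : ℤ → Sign) (N : ℕ) : |corrAvg (fwd x) mu N| ≤ 1 := by
  rcases Nat.eq_zero_or_pos N with rfl | hN
  · simp [corrAvg]
  have hN' : (0 : ℝ) < N := by exact_mod_cast hN
  rw [corrAvg, one_div_mul_eq_div, abs_div, abs_of_pos hN', div_le_one hN']
  calc |∑ i ∈ Finset.Icc 1 N, fwd x i * mu i|
      ≤ ∑ i ∈ Finset.Icc 1 N, |fwd x i * mu i| := Finset.abs_sum_le_sum_abs _ _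
    _ ≤ ∑ i ∈ Finset.Icc 1 N, 1 := Finset.sum_le_sum fun i _ => abs_fwd_mul_mu_le_one x i
    _ = N := by simp

lemma isBoundedUnder_le_corrAvg (x : ℤ → Sign) :
    IsBoundedUnder (· ≤ ·) atTop (corrAvg (fwd x) mu) :=
  isBoundedUnder_of ⟨1, fun N => (abs_le.1 (abs_corrAvg_le_one x N)).2⟩

lemma stronglyCorrelated_of_eventually {x : ℤ → Sign}
    (h : ∀ᶠ N in atTop, 1 / 8 ≤ corrAvg (fwd x) mu N) : StronglyCorrelated (fwd x) mu :=
  (by norm_num : (0 : ℝ) < 1 / 8).trans_le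
    (le_liminf_of_le (isBoundedUnder_le_corrAvg x).isCoboundedUnder_ge h)

lemma weaklyCorrelated_of_frequently {x : ℤ → Sign}
    (h : ∃ᶠ N in atTop, 1 / 16 < corrAvg (fwd x) mu N) : WeaklyCorrelated (fwd x) mu :=
  (by norm_num : (0 : ℝ) < 1 / 16).trans_le
    (le_limsup_of_frequently_le (h.mono fun _ => le_of_lt) (isBoundedUnder_le_corrAvg x))

lemma continuous_corrAvg (N : ℕ) : Continuous fun x : ℤ → Sign => corrAvg (fwd x) mu N := by
  unfold corrAvg fwd
  refine continuous_const.mul (continuous_finsetSum _ fun i _ => Continuous.mul ?_ continuous_const)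
  exact continuous_of_discreteTopology.comp
    (continuous_subtype_val.comp (continuous_apply (i : ℤ)))

/-! ### Density and residuality -/

/-- A window of a shift of `base` is decided by finitely many stages, so the remaining coordinates
can be chosen freely. -/
lemma dense_eventually_le_corrAvg :
    Dense {x : toeplitzSubshift.carrier | ∀ᶠ N in atTop, 1 / 8 ≤ corrAvg (fwd x) mu N} := by
  have hshift : ∀ k : ℤ, shift k base ∈ closure {x : ℤ → Sign |
      x ∈ toeplitzSubshift.carrier ∧ ∀ᶠ N in atTop, 1 / 8 ≤ corrAvg (fwd x) mu N} := by
    refine fun k => mem_closure_of_forall_finset fun U => ?_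
    choose j hj using fun n => exists_hit_zero (k + n)
    let J := U.sup j + 1
    let ω : Odometer := fun i => if i < J then k else center i
    refine ⟨fill ω moebiusSign, ⟨fill_mem _ _, eventually_le_corrAvg (J := J) fun i hi => ?_⟩,
      fun n hn => ?_⟩
    · exact if_neg hi.not_gt
    · have hle := Finset.le_sup (f := j) hn
      rw [shift_apply, base]
      refine (fill_congr _ _ (hj n) fun i hi => ?_).symm
      have hω : ω i = k := if_pos (by omega)
      rw [hit_add_iff, Hit, Hit, hω, zero_add]
  rw [Subtype.dense_iff]
  refine closure_minimal ?_ isClosed_closure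
  rintro _ ⟨k, rfl⟩
  refine closure_mono ?_ (hshift k)
  rintro x ⟨hx, hx'⟩
  exact ⟨⟨x, hx⟩, hx', rfl⟩

/-- The points with infinitely many averages above `1 / 16` form a `G_δ` set, which is dense because
it contains the points whose averages are eventually at least `1 / 8`. -/
lemma frequently_lt_corrAvg_mem_residual :
    {x : toeplitzSubshift.carrier | ∃ᶠ N in atTop, 1 / 16 < corrAvg (fwd x) mu N} ∈
      residual toeplitzSubshift.carrier := by
  have h : ∀ M : ℕ, (⋃ N ≥ M, {x : toeplitzSubshift.carrier | 1 / 16 < corrAvg (fwd x) mu N}) ∈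
      residual toeplitzSubshift.carrier := fun M => by
    refine residual_of_dense_open ?_ (dense_eventually_le_corrAvg.mono fun x hx => ?_)
    · exact isOpen_biUnion fun N _ => isOpen_lt continuous_const
        ((continuous_corrAvg N).comp continuous_subtype_val)
    · obtain ⟨N, hN, hMN⟩ := (Eventually.and hx (eventually_ge_atTop M)).exists
      have : (1 / 16 : ℝ) < corrAvg (fwd x) mu N := lt_of_lt_of_le (by norm_num) hN
      exact Set.mem_biUnion (show N ≥ M from hMN) this
  filter_upwards [countable_iInter_mem.2 h] with x hx
  refine frequently_atTop.2 fun M => ?_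
  simpa using Set.mem_iInter.1 hx M

end ToeplitzMoebius

end

theorem mainTheorem5 :
    ∃ X : SymbolicDynamics.FullShift.Subshift ToeplitzMoebius.Sign ℤ,
      ToeplitzMoebius.IsToeplitzSubshift X ∧
      ¬ ToeplitzMoebius.IsRegular X ∧
      (∃ x ∈ X.carrier,
        ToeplitzMoebius.StronglyCorrelated (ToeplitzMoebius.fwd x) ToeplitzMoebius.mu) ∧
      Dense {x : X.carrier |
        ToeplitzMoebius.StronglyCorrelated (ToeplitzMoebius.fwd x) ToeplitzMoebius.mu} ∧
      {x : X.carrier |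
        ToeplitzMoebius.WeaklyCorrelated (ToeplitzMoebius.fwd x) ToeplitzMoebius.mu} ∈
          residual X.carrier := by
  have hdense := ToeplitzMoebius.dense_eventually_le_corrAvg.mono fun _ hx =>
    ToeplitzMoebius.stronglyCorrelated_of_eventually hx
  have : Nonempty ToeplitzMoebius.toeplitzSubshift.carrier :=
    ⟨⟨_, ToeplitzMoebius.fill_mem (fun _ => 0) fun _ => ToeplitzMoebius.plus⟩⟩
  obtain ⟨x, hx⟩ := hdense.nonempty
  refine ⟨ToeplitzMoebius.toeplitzSubshift,
    ⟨ToeplitzMoebius.base, ToeplitzMoebius.isToeplitzSeq_base, rfl⟩,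
    ToeplitzMoebius.not_isRegular_toeplitzSubshift, ⟨x, x.2, hx⟩, hdense, ?_⟩
  filter_upwards [ToeplitzMoebius.frequently_lt_corrAvg_mem_residual] with y hy
  exact ToeplitzMoebius.weaklyCorrelated_of_frequently hy
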